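/- A simplicial complex on a finite set $V$ is a collection of subsets of $V$ that is closed under passing to subsets. Let $m\ge 0$ and $[m]=\{1,\dots,m\}$. Let $M$ be a simplicial complex on $[m]$. For $i\in[m]$ let $K_i$ be a simplicial complex on a finite set $V_i$ and $L_i\subseteq K_i$ a subcomplex that contains the empty simplex. Define the simplicial polyhedral join \[ \mathcal Z^*_M(\underline K,\underline L)=\bigcup_{\sigma\in M} J^\sigma_1*\cdots*J^\sigma_m,\qquad J^\sigma_i=K_i \text{ if } i\in\sigma,\quad J^\sigma_i=L_i\text{ if } i\notin\sigma, \] where $J_1*\cdots*J_m=\{\tau\subseteq\bigsqcup_{i} V_i : \tau\cap V_i\in J_i \text{ for all } i\in[m]\}$ is the simplicial join. For a family of pairs of spaces $A_i\subseteq X_i$ define the topological polyhedral join, as a subspace of the iterated topological join $X_1*\cdots*X_m$, by \[ \mathcal Z^*_M(\underline X,\underline A)=\bigcup_{\sigma\in M} Y^\sigma_1*\cdots*Y^\sigma_m,\qquad Y^\sigma_i=X_i \text{ if } i\in\sigma,\quad Y^\sigma_i=A_i\text{ if } i\notin\sigma, \] where $X*Y$ is the quotient of $X\sqcup(X\times[0,1]\times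 Y)\sqcup Y$ by $(x,0,y)\sim x$ and $(x,1,y)\sim y$ (so that $X*\emptyset=X$ and $\emptyset * Y=Y$), and the join of no spaces is $\emptyset$. Then, writing $|\cdot|$ for geometric realization, there is a homeomorphism \[ \bigl|\mathcal Z^*_M(\underline K,\underline L)\bigr|\;\cong\;\mathcal Z^*_M\bigl(|\underline K|,|\underline L|\bigr), \] where $|\underline K|=\{|K_i|\}_{i\in[m]}$ and $|\underline L|=\{|L_i|\}_{i\in[m]}$. -/

import Mathlib

universe u v

namespace PolyhedralJoin

/-- A simplicial complex on the vertex set `V`: a collection of finite subsets of `V` that is closed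
under passing to subsets. The empty simplex is allowed as an element, and an element of `V` need
not be a simplex. Subcomplexes are ordered by `≤`. -/
abbrev SimplicialComplex (V : Type u) : Type u := LowerSet (Finset V)

/-- The geometric realization of a simplicial complex on a finite vertex set `V`, in barycentric
coordinates: the union of the closed simplices `|σ|`, `σ ∈ K`, inside the standard simplex in
`V → ℝ`, with the subspace topology. -/
def realization {V : Type u} [Fintype V] (K : SimplicialComplex V) : Set (V → ℝ) :=
  {x | x ∈ stdSimplex ℝ V ∧ ∃ σ ∈ K, ∀ v, v ∉ σ → x v = 0}

/-- The simplicial join of a family of simplicial complexes: the simplicial complex on the disjoint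
union of the vertex sets whose simplices are the `τ` such that, for every `i`, the part of `τ` in
the `i`-th vertex set is a simplex of the `i`-th complex. -/
noncomputable def simplicialJoin {ι : Type v} {V : ι → Type u}
    (J : ∀ i, SimplicialComplex (V i)) : SimplicialComplex (Σ i, V i) where
  carrier := {τ | ∀ i, τ.preimage (Sigma.mk i) sigma_mk_injective.injOn ∈ J i}
  lower' := by
    intro τ ρ hρτ hτ i
    refine (J i).lower ?_ (hτ i)
    intro v hv
    rw [Finset.mem_preimage] at hv ⊢
    exact hρτ hv

/-- The simplicial polyhedral join of a family of pairs `(K i, L i)` over `M`: the union, over the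
simplices `σ` of `M`, of the simplicial joins of the complexes `K i` for `i ∈ σ` and `L i` for
`i ∉ σ`. -/
noncomputable def simplicialPolyhedralJoin {m : ℕ} (M : SimplicialComplex (Fin m))
    {V : Fin m → Type u} (K L : ∀ i, SimplicialComplex (V i)) : SimplicialComplex (Σ i, V i) :=
  ⨆ σ ∈ M, simplicialJoin fun i => if i ∈ σ then K i else L i

/-- The identifications that define the join of two spaces: `(x, 0, y) ∼ x` and `(x, 1, y) ∼ y`. -/
inductive JoinRel (X Y : Type u) :
    X ⊕ (X × unitInterval × Y) ⊕ Y → X ⊕ (X × unitInterval × Y) ⊕ Y → Prop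
  | left (x : X) (y : Y) : JoinRel X Y (Sum.inr (Sum.inl (x, 0, y))) (Sum.inl x)
  | right (x : X) (y : Y) : JoinRel X Y (Sum.inr (Sum.inl (x, 1, y))) (Sum.inr (Sum.inr y))

/-- The join `X * Y`: the quotient of `X ⊔ (X × [0,1] × Y) ⊔ Y` by `(x, 0, y) ∼ x` and
`(x, 1, y) ∼ y`. The summands `X` and `Y` make `X * ∅ = X` and `∅ * Y = Y`. -/
def Join (X Y : Type u) : Type u := Quot (JoinRel X Y)

instance {X Y : Type u} [TopologicalSpace X] [TopologicalSpace Y] : TopologicalSpace (Join X Y) :=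
  inferInstanceAs (TopologicalSpace (Quot (JoinRel X Y)))

/-- The map `f * g : X * Y → X' * Y'` induced by `f : X → X'` and `g : Y → Y'`. -/
def Join.map {X X' Y Y' : Type u} (f : X → X') (g : Y → Y') : Join X Y → Join X' Y' :=
  Quot.map (Sum.map f (Sum.map (Prod.map f (Prod.map id g)) g)) (by
    rintro _ _ (⟨x, y⟩ | ⟨x, y⟩)
    · exact JoinRel.left (f x) (g y)
    · exact JoinRel.right (f x) (g y))

/-- The iterated join `X₁ * (X₂ * (⋯ * Xₘ))`. The join of no spaces is empty. -/
def IterJoin : (m : ℕ) → (Fin m → Type u) → Type u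
  | 0, _ => PEmpty
  | m + 1, X => Join (X 0) (IterJoin m fun i => X i.succ)

/-- The topology of the iterated join. -/
@[reducible] def IterJoin.topology : (m : ℕ) → (X : Fin m → Type u) → (∀ i, TopologicalSpace (X i)) →
    TopologicalSpace (IterJoin m X)
  | 0, _, _ => (⊥ : TopologicalSpace PEmpty)
  | m + 1, X, t =>
    letI := t 0
    letI := IterJoin.topology m (fun i => X i.succ) fun i => t i.succ
    inferInstanceAs (TopologicalSpace (Join (X 0) (IterJoin m fun i => X i.succ)))

instance {m : ℕ} {X : Fin m → Type u} [t : ∀ i, TopologicalSpace (X i)] :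
    TopologicalSpace (IterJoin m X) :=
  IterJoin.topology m X t

/-- The map of iterated joins induced by a family of maps. -/
def IterJoin.map : (m : ℕ) → {X Y : Fin m → Type u} → (∀ i, X i → Y i) →
    IterJoin m X → IterJoin m Y
  | 0, _, _, _ => id
  | m + 1, _, _, f => Join.map (f 0) (IterJoin.map m fun i => f i.succ)

/-- The subspace `Y₁ * ⋯ * Yₘ` of `X₁ * ⋯ * Xₘ`, for subspaces `Yᵢ ⊆ Xᵢ`: the image of the join of
the inclusions. -/
def subJoin {m : ℕ} {X : Fin m → Type u} (Y : ∀ i, Set (X i)) : Set (IterJoin m X) :=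
  Set.range (IterJoin.map m fun i => (Subtype.val : Y i → X i))

/-- The polyhedral join of a family of pairs of spaces `(X i, A i)`, `A i ⊆ X i`, over `M`: the
union in `X₁ * ⋯ * Xₘ`, over the simplices `σ` of `M`, of the joins of the `X i` for `i ∈ σ` and
the `A i` for `i ∉ σ`, with the subspace topology. -/
def polyhedralJoin {m : ℕ} (M : SimplicialComplex (Fin m)) (X : Fin m → Type u)
    (A : ∀ i, Set (X i)) : Set (IterJoin m X) :=
  ⋃ σ ∈ M, subJoin fun i => if i ∈ σ then Set.univ else A i

end PolyhedralJoin

/-!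
The homeomorphism is given by barycentric coordinates. A point of `X₁ * ⋯ * Xₘ` with
`Xᵢ = |Kᵢ| ⊆ ℝ^{Vᵢ}` is a formal convex combination of points `xᵢ`, and sending it to the family of
vectors `tᵢ xᵢ`, where `tᵢ` is the weight of `xᵢ`, is a continuous map `IterJoin.coord` into
`∏ᵢ ℝ^{Vᵢ} = ℝ^{⊔ᵢ Vᵢ}`.

* It is injective (`IterJoin.coord_injective`), because the sum of the coordinates of `tᵢ xᵢ` is the
  weight `tᵢ`, and `xᵢ` is recovered from `tᵢ xᵢ` as soon as `tᵢ ≠ 0`.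
* The iterated join of the compact spaces `|Kᵢ|` is compact and the target is Hausdorff, so the map
  is an embedding and restricts to a homeomorphism from every subspace onto its image.
* By `IterJoin.range_coord`, the image of a join consists of the families of total weight `1`
  whose `i`-th member is zero or a positive multiple of a point of the `i`-th space. For the
  realization of a complex `J` that contains `∅`, these members are the nonnegative vectors
  supported on a simplex of `J`, so the image of `|J₁| * ⋯ * |Jₘ|` is `|J₁ * ⋯ * Jₘ|`.

Taking the union over the simplices of `M` gives the theorem, as both realization and image commute
with unions.
-/

namespace PolyhedralJoin

open Topology

/-! ### Coordinates on the join of two spaces -/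

section Join

variable {X Y X' Y' : Type u} {E F : Type*} [AddCommGroup E] [Module ℝ E] [AddCommGroup F]
  [Module ℝ F]

/-- The map `X * Y → E × F`, `(x, t, y) ↦ ((1 - t) f x, t g y)`, given by maps `f : X → E` and
`g : Y → F` into real vector spaces. -/
def Join.coord (f : X → E) (g : Y → F) : Join X Y → E × F :=
  Quot.lift
    (Sum.elim (fun x => (f x, 0))
      (Sum.elim (fun p => ((1 - (p.2.1 : ℝ)) • f p.1, (p.2.1 : ℝ) • g p.2.2))
        (fun y => (0, g y))))
    (by rintro _ _ (⟨x, y⟩ | ⟨x, y⟩) <;> simp)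

theorem Join.continuous_coord [TopologicalSpace X] [TopologicalSpace Y] [TopologicalSpace E]
    [ContinuousSMul ℝ E] [TopologicalSpace F] [ContinuousSMul ℝ F] {f : X → E} {g : Y → F}
    (hf : Continuous f) (hg : Continuous g) : Continuous (Join.coord f g) :=
  continuous_quot_lift _ (Continuous.sumElim (by fun_prop)
    (Continuous.sumElim (by fun_prop) (by fun_prop)))

theorem Join.coord_map (f : X' → E) (g : Y' → F) (a : X → X') (b : Y → Y') (p : Join X Y) :
    Join.coord f g (Join.map a b p) = Join.coord (f ∘ a) (g ∘ b) p := by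
  rcases p with ⟨x | ⟨x, t, y⟩ | y⟩ <;> rfl

/-- Normal form of the points of a join: the ends of the segments `{x} × [0, 1] × {y}` are
identified with points of `X` and of `Y`, so the segment parameter may be taken in `(0, 1)`. -/
theorem Join.exists_rep (p : Join X Y) :
    (∃ x, p = Quot.mk _ (Sum.inl x)) ∨ (∃ y, p = Quot.mk _ (Sum.inr (Sum.inr y))) ∨
      ∃ (x : X) (t : unitInterval) (y : Y), 0 < (t : ℝ) ∧ (t : ℝ) < 1 ∧
        p = Quot.mk _ (Sum.inr (Sum.inl (x, t, y))) := by
  rcases p with ⟨x | ⟨x, t, y⟩ | y⟩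
  · exact .inl ⟨x, rfl⟩
  · rcases eq_or_ne t 0 with rfl | h0
    · exact .inl ⟨x, Quot.sound (.left x y)⟩
    rcases eq_or_ne t 1 with rfl | h1
    · exact .inr (.inl ⟨y, Quot.sound (.right x y)⟩)
    exact .inr (.inr ⟨x, t, y, unitInterval.pos_iff_ne_zero.2 h0,
      unitInterval.lt_one_iff_ne_one.2 h1, rfl⟩)
  · exact .inr (.inl ⟨y, rfl⟩)

/-- The functional `w` reads off the weight `1 - t` of the first factor. -/
theorem Join.coord_injective {f : X → E} {g : Y → F} (hf : f.Injective) (hg : g.Injective)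
    (w : E →ₗ[ℝ] ℝ) (hw : ∀ x, w (f x) = 1) : (Join.coord f g).Injective := by
  intro p q h
  rcases p.exists_rep with ⟨x, rfl⟩ | ⟨y, rfl⟩ | ⟨x, t, y, h0, h1, rfl⟩ <;>
  rcases q.exists_rep with ⟨x', rfl⟩ | ⟨y', rfl⟩ | ⟨x', t', y', h0', h1', rfl⟩ <;>
  obtain ⟨h₁, h₂⟩ := Prod.ext_iff.1 h <;>
  have h₃ := congrArg w h₁ <;>
  simp only [Join.coord, Sum.elim_inl, Sum.elim_inr, map_smul, map_zero, hw, smul_eq_mul,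
    mul_one] at h₁ h₂ h₃
  · rw [hf h₁]
  · norm_num at h₃
  · linarith
  · norm_num at h₃
  · rw [hg h₂]
  · linarith
  · linarith
  · linarith
  · obtain rfl : t = t' := Subtype.ext (by linarith)
    rw [hf (smul_right_injective E (sub_pos.2 h1).ne' h₁),
      hg (smul_right_injective F h0.ne' h₂)]

instance [TopologicalSpace X] [TopologicalSpace Y] [CompactSpace X] [CompactSpace Y] :
    CompactSpace (Join X Y) :=
  inferInstanceAs (CompactSpace (Quot (JoinRel X Y)))

end Join

/-! ### Coordinates on the iterated join -/

section IterJoin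

/-- The map `X₁ * ⋯ * Xₘ → ∏ᵢ Eᵢ` given by maps `fᵢ : Xᵢ → Eᵢ` into real vector spaces: its `i`-th
component is `fᵢ` of the `i`-th point, scaled by the weight of this point in the join. -/
def IterJoin.coord : (m : ℕ) → {X : Fin m → Type u} → {E : Fin m → Type v} →
    [∀ i, AddCommGroup (E i)] → [∀ i, Module ℝ (E i)] → (∀ i, X i → E i) →
    IterJoin m X → ∀ i, E i
  | 0, _, _, _, _, _ => fun _ i => i.elim0
  | m + 1, _, E, _, _, f => fun p =>
    let q := Join.coord (f 0) (IterJoin.coord m fun i => f i.succ) p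
    Fin.cons (α := E) q.1 q.2

theorem IterJoin.continuous_coord {m : ℕ} {X : Fin m → Type u} {E : Fin m → Type v}
    [∀ i, AddCommGroup (E i)] [∀ i, Module ℝ (E i)] [∀ i, TopologicalSpace (X i)]
    [∀ i, TopologicalSpace (E i)] [∀ i, ContinuousSMul ℝ (E i)] {f : ∀ i, X i → E i}
    (hf : ∀ i, Continuous (f i)) : Continuous (IterJoin.coord m f) := by
  induction m with
  | zero => exact continuous_pi fun i => i.elim0
  | succ m ih =>
    have h := Join.continuous_coord (hf 0) (ih fun i => hf i.succ)
    exact Continuous.finCons (continuous_fst.comp h) (continuous_snd.comp h)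

theorem IterJoin.coord_map {m : ℕ} {X Y : Fin m → Type u} {E : Fin m → Type v}
    [∀ i, AddCommGroup (E i)] [∀ i, Module ℝ (E i)] (f : ∀ i, Y i → E i) (a : ∀ i, X i → Y i)
    (p : IterJoin m X) :
    IterJoin.coord m f (IterJoin.map m a p) = IterJoin.coord m (fun i => f i ∘ a i) p := by
  induction m with
  | zero => exact p.elim
  | succ m ih =>
    have h : IterJoin.coord m (fun i => f i.succ) ∘ IterJoin.map m (fun i => a i.succ) =
        IterJoin.coord m fun i => f i.succ ∘ a i.succ :=
      funext (ih (fun i => f i.succ) fun i => a i.succ)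
    have e := Join.coord_map (f 0) (IterJoin.coord m fun i => f i.succ) (a 0)
      (IterJoin.map m fun i => a i.succ) p
    rw [h] at e
    exact congrArg (fun q => Fin.cons (α := E) q.1 q.2) e

theorem IterJoin.coord_injective {m : ℕ} {X : Fin m → Type u} {E : Fin m → Type v}
    [∀ i, AddCommGroup (E i)] [∀ i, Module ℝ (E i)] {f : ∀ i, X i → E i}
    (hf : ∀ i, (f i).Injective) (w : ∀ i, E i →ₗ[ℝ] ℝ) (hw : ∀ i x, w i (f i x) = 1) :
    (IterJoin.coord m f).Injective := by
  induction m with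
  | zero => exact fun p => p.elim
  | succ m ih =>
    intro p q h
    obtain ⟨h₁, h₂⟩ := Fin.cons_injective2 h
    exact Join.coord_injective (hf 0) (ih (fun i => hf i.succ) (fun i => w i.succ)
      fun i => hw i.succ) (w 0) (hw 0) (Prod.ext h₁ h₂)

/-- The functionals `w i` measure the weights, which sum to `1` on the join. The alternative
`z i = 0` is needed since `X i` may be empty. -/
theorem IterJoin.range_coord {m : ℕ} {X : Fin m → Type u} {E : Fin m → Type v}
    [∀ i, AddCommGroup (E i)] [∀ i, Module ℝ (E i)] (f : ∀ i, X i → E i)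
    (w : ∀ i, E i →ₗ[ℝ] ℝ) (hw : ∀ i x, w i (f i x) = 1) :
    Set.range (IterJoin.coord m f) =
      {z | ∑ i, w i (z i) = 1 ∧ ∀ i, z i = 0 ∨ ∃ c : ℝ, 0 < c ∧ ∃ x, z i = c • f i x} := by
  induction m with
  | zero =>
    ext z
    simp only [Set.mem_range, Set.mem_ofPred_eq, Finset.univ_eq_empty, Finset.sum_empty,
      zero_ne_one, false_and, iff_false, not_exists]
    exact fun p => p.elim
  | succ m ih =>
    have ih := fun z => Set.ext_iff.1
      (ih (fun i => f i.succ) (fun i => w i.succ) fun i => hw i.succ) z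
    simp only [Set.mem_range, Set.mem_ofPred_eq] at ih
    ext z
    refine Fin.consCases (fun z₀ z' => ?_) z
    simp only [Set.mem_range, Set.mem_ofPred_eq, Fin.sum_univ_succ, Fin.forall_fin_succ,
      Fin.cons_zero, Fin.cons_succ]
    have key : ∀ p : IterJoin (m + 1) X, IterJoin.coord (m + 1) f p = (Fin.cons z₀ z' : ∀ i, E i) ↔
        Join.coord (f 0) (IterJoin.coord m fun i => f i.succ) p = (z₀, z') := fun p => by
      rw [Prod.ext_iff]
      exact Fin.cons_inj
    simp only [key]
    constructor
    · rintro ⟨p, hp⟩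
      rcases Join.exists_rep p with ⟨x, rfl⟩ | ⟨y, rfl⟩ | ⟨x, t, y, h0, h1, rfl⟩ <;>
      obtain ⟨rfl, rfl⟩ := Prod.ext_iff.1 hp
      · refine ⟨by simp [Join.coord, hw], .inr ⟨1, one_pos, x, by simp [Join.coord]⟩,
          fun i => .inl (by simp [Join.coord])⟩
      · obtain ⟨hs, hy⟩ := (ih _).1 ⟨y, rfl⟩
        exact ⟨by simpa [Join.coord] using hs, .inl rfl, hy⟩
      · obtain ⟨hs, hy⟩ := (ih _).1 ⟨y, rfl⟩
        refine ⟨?_, .inr ⟨1 - t, sub_pos.2 h1, x, rfl⟩, fun i => ?_⟩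
        · simp only [Join.coord, Sum.elim_inl, Sum.elim_inr, map_smul, hw, Pi.smul_apply,
            ← Finset.mul_sum, hs, smul_eq_mul]
          ring
        · rcases hy i with h | ⟨c, hc, x', h⟩
          · exact .inl (by simp [Join.coord, h])
          · exact .inr ⟨t * c, mul_pos h0 hc, x', by simp [Join.coord, h, mul_smul]⟩
    · rintro ⟨hs, h₀, h'⟩
      rcases h₀ with rfl | ⟨c, hc, x, rfl⟩
      · obtain ⟨y, rfl⟩ := (ih z').2 ⟨by simpa using hs, h'⟩
        exact ⟨Quot.mk _ (Sum.inr (Sum.inr y)), rfl⟩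
      · rcases eq_or_ne z' 0 with rfl | hz
        · have hc1 : c = 1 := by simpa [hw] using hs
          exact ⟨Quot.mk _ (Sum.inl x), by simp [Join.coord, hc1]⟩
        -- The remaining weight `1 - c` is positive, so `z'` can be normalized to weight `1`.
        have hnn : ∀ i, 0 ≤ w i.succ (z' i) := fun i => by
          rcases h' i with h | ⟨d, hd, x, h⟩
          · simp [h]
          · simp [h, hw, hd.le]
        have hpos : 0 < ∑ i, w i.succ (z' i) := by
          obtain ⟨i, hi⟩ := Function.ne_iff.1 hz
          refine Finset.sum_pos' (fun i _ => hnn i) ⟨i, Finset.mem_univ i, ?_⟩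
          rcases h' i with h | ⟨d, hd, x, h⟩
          · exact absurd h hi
          · simpa [h, hw] using hd
        have hsc : ∑ i, w i.succ (z' i) = 1 - c := by
          simp only [map_smul, hw, smul_eq_mul, mul_one] at hs
          linarith
        rw [hsc] at hpos
        obtain ⟨y, hy⟩ := (ih ((1 - c)⁻¹ • z')).2 ⟨by
            simp only [Pi.smul_apply, map_smul, ← Finset.mul_sum, hsc, smul_eq_mul]
            exact inv_mul_cancel₀ hpos.ne', fun i => by
            rcases h' i with h | ⟨d, hd, x, h⟩
            · exact .inl (by simp [h])
            · exact .inr ⟨(1 - c)⁻¹ * d, by positivity, x, by simp [h, mul_smul]⟩⟩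
        refine ⟨Quot.mk _ (Sum.inr (Sum.inl (x, ⟨1 - c, hpos.le, by linarith⟩, y))), ?_⟩
        simp [Join.coord, hy, smul_inv_smul₀ hpos.ne']

theorem IterJoin.compactSpace {m : ℕ} {X : Fin m → Type u} [∀ i, TopologicalSpace (X i)]
    [∀ i, CompactSpace (X i)] : CompactSpace (IterJoin m X) := by
  induction m with
  | zero => exact @Finite.compactSpace _ _ (inferInstanceAs (Finite PEmpty))
  | succ m ih =>
    have := ih (X := fun i => X i.succ)
    exact inferInstanceAs (CompactSpace (Join (X 0) (IterJoin m fun i => X i.succ)))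

end IterJoin

/-! ### Geometric realizations -/

section Realization

instance {V : Type u} [Fintype V] (K : SimplicialComplex V) : CompactSpace (realization K) := by
  rw [← isCompact_iff_compactSpace]
  have h : realization K = stdSimplex ℝ V ∩
      ⋃ σ ∈ (K : Set (Finset V)), ⋂ v, ⋂ (_ : v ∉ σ), {x : V → ℝ | x v = 0} := by
    ext x
    simp [realization]
  rw [h]
  exact (isCompact_stdSimplex ℝ V).inter_right <| (Set.toFinite _).isClosed_biUnion fun σ _ =>
    isClosed_iInter fun v => isClosed_iInter fun _ =>
      isClosed_eq (continuous_apply v) continuous_const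

theorem realization_mono {V : Type u} [Fintype V] {K L : SimplicialComplex V} (h : L ≤ K) :
    realization L ⊆ realization K :=
  fun _ ⟨hx, σ, hσ, h0⟩ => ⟨hx, σ, h hσ, h0⟩

theorem realization_biSup {V : Type u} [Fintype V] {α : Type*} (S : Set α)
    (J : α → SimplicialComplex V) :
    realization (⨆ a ∈ S, J a) = ⋃ a ∈ S, realization (J a) := by
  ext x
  simp only [realization, Set.mem_ofPred_eq, LowerSet.mem_iSup_iff, Set.mem_iUnion, exists_prop]
  tauto

/-- The sum of the coordinates, as a linear functional. -/
def coordSum (V : Type u) [Fintype V] : (V → ℝ) →ₗ[ℝ] ℝ := ∑ v, LinearMap.proj v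

theorem coordSum_apply {V : Type u} [Fintype V] (x : V → ℝ) : coordSum V x = ∑ v, x v := by
  simp [coordSum]

/-- The cone over `|J|` consists of the nonnegative vectors supported on a simplex of `J`. -/
theorem eq_zero_or_exists_smul_realization_iff {V : Type u} [Fintype V] {J : SimplicialComplex V}
    (hJ : ∅ ∈ J) (z : V → ℝ) :
    (z = 0 ∨ ∃ c : ℝ, 0 < c ∧ ∃ x ∈ realization J, z = c • x) ↔
      (∀ v, 0 ≤ z v) ∧ ∃ σ ∈ J, ∀ v, v ∉ σ → z v = 0 := by
  constructor
  · rintro (rfl | ⟨c, hc, x, ⟨⟨hx, -⟩, σ, hσ, h⟩, rfl⟩)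
    · exact ⟨fun _ => le_rfl, ∅, hJ, fun _ _ => rfl⟩
    · exact ⟨fun v => mul_nonneg hc.le (hx v), σ, hσ, fun v hv => by simp [h v hv]⟩
  · rintro ⟨hz, σ, hσ, h⟩
    rcases eq_or_ne z 0 with h0 | h0
    · exact .inl h0
    have hs : 0 < ∑ v, z v := by
      obtain ⟨v, hv⟩ := Function.ne_iff.1 h0
      exact Finset.sum_pos' (fun v _ => hz v) ⟨v, Finset.mem_univ v, (hz v).lt_of_ne' hv⟩
    refine .inr ⟨∑ v, z v, hs, (∑ v, z v)⁻¹ • z, ⟨⟨fun v => ?_, ?_⟩, σ, hσ, fun v hv => ?_⟩, ?_⟩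
    · exact mul_nonneg (inv_nonneg.2 hs.le) (hz v)
    · simp only [Pi.smul_apply, smul_eq_mul, ← Finset.mul_sum]
      exact inv_mul_cancel₀ hs.ne'
    · simp [h v hv]
    · rw [smul_inv_smul₀ hs.ne']

theorem mem_realization_simplicialJoin_iff {m : ℕ} {V : Fin m → Type u} [∀ i, Fintype (V i)]
    (J : ∀ i, SimplicialComplex (V i)) (z : ∀ i, V i → ℝ) :
    (fun s : Σ i, V i => z s.1 s.2) ∈ realization (simplicialJoin J) ↔
      ∑ i, coordSum (V i) (z i) = 1 ∧
        ∀ i, (∀ v, 0 ≤ z i v) ∧ ∃ σ ∈ J i, ∀ v, v ∉ σ → z i v = 0 := by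
  simp only [realization, stdSimplex, Set.mem_ofPred_eq, Fintype.sum_sigma, Sigma.forall,
    coordSum_apply]
  constructor
  · rintro ⟨⟨hz, hs⟩, σ, hσ, h⟩
    refine ⟨hs, fun i => ⟨hz i, _, hσ i, fun v hv => h i v ?_⟩⟩
    simpa using hv
  · rintro ⟨hs, h⟩
    choose hz σ hσ h using h
    refine ⟨⟨hz, hs⟩, Finset.univ.sigma σ, fun i => ?_, fun i v hv => h i v ?_⟩
    · convert hσ i
      ext v
      simp
    · simpa using hv

end Realization

/-! ### Comparison of the polyhedral joins -/

/-- Barycentric coordinates on the iterated join of the spaces `|K i|`, as functions on the disjoint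
union of the vertex sets. -/
def barycentric {m : ℕ} {V : Fin m → Type u} [∀ i, Fintype (V i)]
    (K : ∀ i, SimplicialComplex (V i)) (p : IterJoin m fun i => realization (K i)) :
    (Σ i, V i) → ℝ :=
  fun s => IterJoin.coord m (fun i => (Subtype.val : realization (K i) → V i → ℝ)) p s.1 s.2

section Barycentric

variable {m : ℕ} {V : Fin m → Type u} [∀ i, Fintype (V i)]

theorem coordSum_realization {W : Type u} [Fintype W] {K : SimplicialComplex W}
    (x : realization K) : coordSum W x.1 = 1 :=
  (coordSum_apply _).trans x.2.1.2

theorem isEmbedding_barycentric (K : ∀ i, SimplicialComplex (V i)) :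
    IsEmbedding (barycentric K) := by
  have := IterJoin.compactSpace (X := fun i => realization (K i))
  refine (Continuous.isClosedEmbedding ?_ ?_).isEmbedding
  · have h := IterJoin.continuous_coord
      fun i => (continuous_subtype_val : Continuous (Subtype.val : realization (K i) → V i → ℝ))
    exact continuous_pi fun s =>
      (continuous_apply s.2).comp ((continuous_apply s.1).comp h)
  · intro p q h
    refine IterJoin.coord_injective (fun i => Subtype.val_injective) (fun i => coordSum (V i))
      (fun i => coordSum_realization) ?_
    ext i v
    exact congrFun h ⟨i, v⟩

/-- Subcomplexes `J i ≤ K i` that contain the empty simplex span in `|K₁| * ⋯ * |Kₘ|` the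
realization of their simplicial join. -/
theorem barycentric_image_subJoin {K J : ∀ i, SimplicialComplex (V i)} (hJK : ∀ i, J i ≤ K i)
    (hJ : ∀ i, ∅ ∈ J i) :
    barycentric K '' subJoin (fun i => {x : realization (K i) | x.1 ∈ realization (J i)}) =
      realization (simplicialJoin J) := by
  let Y : ∀ i, Set (realization (K i)) := fun i => {x | x.1 ∈ realization (J i)}
  have hr := Set.ext_iff.1 <| IterJoin.range_coord
    (fun i => (Subtype.val : realization (K i) → V i → ℝ) ∘ (Subtype.val : Y i → realization (K i)))
    (fun i => coordSum (V i)) fun i x => coordSum_realization x.1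
  simp only [Set.mem_range, Set.mem_ofPred_eq] at hr
  have hY : ∀ i (z : V i → ℝ) (c : ℝ),
      (∃ x : Y i, z = c • (Subtype.val ∘ Subtype.val : Y i → V i → ℝ) x) ↔
        ∃ x ∈ realization (J i), z = c • x := fun i z c =>
    ⟨fun ⟨x, h⟩ => ⟨_, x.2, h⟩, fun ⟨x, hx, h⟩ => ⟨⟨⟨x, realization_mono (hJK i) hx⟩, hx⟩, h⟩⟩
  simp only [hY, fun i => eq_zero_or_exists_smul_realization_iff (hJ i),
    ← mem_realization_simplicialJoin_iff] at hr
  rw [subJoin, ← Set.range_comp]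
  ext z
  refine Iff.trans ?_ (hr fun i v => z ⟨i, v⟩)
  refine exists_congr fun p => ?_
  simp only [Function.comp_apply, barycentric, funext_iff, Sigma.forall, IterJoin.coord_map]
  rfl

theorem barycentric_image_polyhedralJoin (M : SimplicialComplex (Fin m))
    {K L : ∀ i, SimplicialComplex (V i)} (hLK : ∀ i, L i ≤ K i) (hL : ∀ i, ∅ ∈ L i) :
    barycentric K '' polyhedralJoin M (fun i => realization (K i))
        (fun i => {x | x.1 ∈ realization (L i)}) =
      realization (simplicialPolyhedralJoin M K L) := by
  have h := realization_biSup (M : Set (Finset (Fin m)))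
    fun σ => simplicialJoin fun i => if i ∈ σ then K i else L i
  refine Eq.trans ?_ h.symm
  rw [polyhedralJoin, Set.image_iUnion₂]
  refine Set.iUnion₂_congr fun σ _ => ?_
  rw [← barycentric_image_subJoin (K := K)]
  · congr 2
    ext i x
    split_ifs
    · simp
    · rfl
  · intro i
    split_ifs
    exacts [le_rfl, hLK i]
  · intro i
    split_ifs
    exacts [hLK i (hL i), hL i]

end Barycentric

end PolyhedralJoin

theorem theorem5 {m : ℕ} (M : PolyhedralJoin.SimplicialComplex (Fin m))
    {V : Fin m → Type u} [∀ i, Fintype (V i)]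
    (K L : ∀ i, PolyhedralJoin.SimplicialComplex (V i))
    (hLK : ∀ i, L i ≤ K i) (hL : ∀ i, ∅ ∈ L i) :
    Nonempty
      ((PolyhedralJoin.realization (PolyhedralJoin.simplicialPolyhedralJoin M K L)) ≃ₜ
        (PolyhedralJoin.polyhedralJoin M
          (fun i => (PolyhedralJoin.realization (K i) : Type u))
          (fun i => {x | x.1 ∈ PolyhedralJoin.realization (L i)}))) := by
  exact ⟨((PolyhedralJoin.isEmbedding_barycentric K).homeomorphImage _ |>.trans
    (Homeomorph.setCongr (PolyhedralJoin.barycentric_image_polyhedralJoin M hLK hL))).symm⟩
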